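/- For a finite simple graph $G=(V,E)$ let $P(G)=\{x\in[0,1]^V : x_u+x_v\le 1 \text{ for all } uv\in E\}$. A variable disjunction is a union $\{x : x_v\le K\}\cup\{x : x_v\ge K+1\}$ with $v\in V$, $K\in\mathbb Z$. A branch-and-bound (BB) proof of $\langle c,x\rangle\le\gamma$ for a set $C\subseteq\mathbb R^V$, based on variable disjunctions, is a finite rooted tree whose nodes represent subsets of $\mathbb R^V$, such that the root represents $C$; the inequality is valid on the set represented by each leaf; and for each non-leaf node, representing $C'$, there is a variable disjunction $Q_1\cup Q_2$ such that the node has exactly two children, which represent $C'\cap Q_1$ and $C'\cap Q_2$. Its size is the number of nodes minus one. A cutting plane (CP) proof of length $N$ of $\langle c,x\rangle\le\gamma$ for $C$, based on variable disjunctions, is a sequence of halfspaces $H_1,\dots,H_N$ such that for each $i=1,\dots,N$ there is a variable disjunction $D_i$ with $C\cap H_1\cap\dots\cap H_{i-1}\cap D_i\subseteq H_i$, and such that the inequality is valid on $C\cap H_1\cap\dots\cap H_N$. Theorem. There is an absolute constant $\kappa$ such that the following holds. Let $0\le\alpha<1$, let $m$ be a natural number, and let $G$ be any graph obtained from $m$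 disjoint copies of the complete graph $K_m$ by adding edges between different copies in such a way that in each copy at most $\alpha m$ vertices have a neighbour in another copy. Then: 1. if $m\ge 3/(1-\alpha)$, every BB proof of $\sum_{v}x_v\le m$ for $P(G)$ based on variable disjunctions has size at least $2^{m+1}-2$; 2. there is a CP proof of $\sum_v x_v\le m$ for $P(G)$ based on variable disjunctions of length at most $\kappa m^4$. -/

import Mathlib

/-- A disjunction covering `S ⊆ ℝ^V`: finitely many closed convex sets whose union contains `S`. -/
structure Disjunction {V : Type*} (S : Set (V → ℝ)) where
  numPieces : ℕ
  piece : Fin numPieces → Set (V → ℝ)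
  isClosed_piece : ∀ i, IsClosed (piece i)
  convex_piece : ∀ i, Convex ℝ (piece i)
  covers : S ⊆ ⋃ i, piece i

/-- The union of the pieces of a disjunction. -/
def Disjunction.toSet {V : Type*} {S : Set (V → ℝ)} (D : Disjunction S) : Set (V → ℝ) :=
  ⋃ i, D.piece i

/-- The inequality `⟨c, x⟩ ≤ γ` is valid for all points of `C`. -/
def ValidIneq {V : Type*} [Fintype V] (c : V → ℝ) (γ : ℝ) (C : Set (V → ℝ)) : Prop :=
  ∀ x ∈ C, c ⬝ᵥ x ≤ γ

/-- `H` is a halfspace of `ℝ^V`. -/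
def IsHalfspace {V : Type*} [Fintype V] (H : Set (V → ℝ)) : Prop :=
  ∃ (a : V → ℝ) (b : ℝ), a ≠ 0 ∧ H = {x | a ⬝ᵥ x ≤ b}

/-- `H` is a cutting plane for `C` derived from the disjunction `D`. -/
def IsCuttingPlane {V : Type*} [Fintype V] {S : Set (V → ℝ)} (C : Set (V → ℝ))
    (D : Disjunction S) (H : Set (V → ℝ)) : Prop :=
  IsHalfspace H ∧ C ∩ D.toSet ⊆ H

/-- `H` is a cutting plane proof of length `N`, based on the family `𝒟` and with respect to
`C ∩ S`, of the inequality `⟨c, x⟩ ≤ γ`. -/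
def IsCPProof {V : Type*} [Fintype V] {S : Set (V → ℝ)} (𝒟 : Set (Disjunction S))
    (C : Set (V → ℝ)) (c : V → ℝ) (γ : ℝ) {N : ℕ} (H : Fin N → Set (V → ℝ)) : Prop :=
  (∃ D : Fin N → Disjunction S, ∀ i, D i ∈ 𝒟 ∧
    IsCuttingPlane (C ∩ ⋂ j : Fin N, ⋂ _ : j < i, H j) (D i) (H i)) ∧
  ValidIneq c γ (C ∩ ⋂ j, H j)

/-- Branch-and-bound proofs, based on the family `𝒟`, of the inequality `⟨c, x⟩ ≤ γ`: finite
rooted trees whose nodes represent sets. The index is the set represented by the root. At a leaf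
the inequality is valid for the represented set; at any other node, representing `C`, some
disjunction `Q₁ ∪ … ∪ Q_k` of `𝒟` is chosen and the children represent `C ∩ Q₁, …, C ∩ Q_k`. -/
inductive BBProof {V : Type*} [Fintype V] {S : Set (V → ℝ)} (𝒟 : Set (Disjunction S))
    (c : V → ℝ) (γ : ℝ) : Set (V → ℝ) → Type _
  | leaf (C : Set (V → ℝ)) (h : ValidIneq c γ C) : BBProof 𝒟 c γ C
  | branch (C : Set (V → ℝ)) (D : Disjunction S) (hD : D ∈ 𝒟)
      (child : ∀ i : Fin D.numPieces, BBProof 𝒟 c γ (C ∩ D.piece i)) : BBProof 𝒟 c γ C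

/-- The number of nodes of a branch-and-bound proof, the root included. -/
def BBProof.numNodes {V : Type*} [Fintype V] {S : Set (V → ℝ)} {𝒟 : Set (Disjunction S)}
    {c : V → ℝ} {γ : ℝ} : {C : Set (V → ℝ)} → BBProof 𝒟 c γ C → ℕ
  | _, .leaf _ _ => 1
  | _, .branch _ _ _ child => 1 + ∑ i, (child i).numNodes

/-- The size of a branch-and-bound proof: the number of its nodes other than the root. -/
def BBProof.size {V : Type*} [Fintype V] {S : Set (V → ℝ)} {𝒟 : Set (Disjunction S)}
    {c : V → ℝ} {γ : ℝ} {C : Set (V → ℝ)} (t : BBProof 𝒟 c γ C) : ℕ :=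
  t.numNodes - 1

/-- The integer lattice `ℤ^V` in `ℝ^V`. -/
def intLattice (V : Type*) : Set (V → ℝ) :=
  {x | ∀ v, ∃ z : ℤ, x v = z}

/-- The variable disjunction `{x | x_v ≤ K} ∪ {x | x_v ≥ K + 1}`. -/
def varDisjunction {V : Type*} (v : V) (K : ℤ) : Disjunction (intLattice V) where
  numPieces := 2
  piece := ![{x | x v ≤ K}, {x | (K : ℝ) + 1 ≤ x v}]
  isClosed_piece := by
    intro i
    fin_cases i
    · exact isClosed_le (continuous_apply v) continuous_const
    · exact isClosed_le continuous_const (continuous_apply v)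
  convex_piece := by
    intro i
    fin_cases i
    · exact convex_halfSpace_le (LinearMap.proj (R := ℝ) (φ := fun _ : V => ℝ) v).isLinear _
    · exact convex_halfSpace_ge (LinearMap.proj (R := ℝ) (φ := fun _ : V => ℝ) v).isLinear _
  covers := by
    intro x hx
    obtain ⟨z, hz⟩ := hx v
    rcases le_or_gt z K with h | h
    · refine Set.mem_iUnion.2 ⟨0, ?_⟩
      change x v ≤ K
      rw [hz]
      exact_mod_cast h
    · refine Set.mem_iUnion.2 ⟨1, ?_⟩
      change (K : ℝ) + 1 ≤ x v
      rw [hz]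
      exact_mod_cast h

/-- The family of all variable disjunctions. -/
def varDisjunctions (V : Type*) : Set (Disjunction (intLattice V)) :=
  {D | ∃ (v : V) (K : ℤ), D = varDisjunction v K}

/-- The standard formulation `P(G)` of the independent set problem on `G`. -/
def stablePolytope {V : Type*} (G : SimpleGraph V) : Set (V → ℝ) :=
  {x | (∀ u v, G.Adj u v → x u + x v ≤ 1) ∧ ∀ v, 0 ≤ x v ∧ x v ≤ 1}

/-- `m` disjoint copies of the complete graph `K_m`; the `i`-th copy has the vertices `(i, j)`. -/
def disjointCliques (m : ℕ) : SimpleGraph (Fin m × Fin m) where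
  Adj p q := p.1 = q.1 ∧ p ≠ q
  symm := ⟨fun _ _ h => ⟨h.1.symm, h.2.symm⟩⟩
  loopless := ⟨fun _ h => h.2 rfl⟩

/-- The number of vertices of the `i`-th clique that have a neighbour in another clique. -/
noncomputable def numConnected {m : ℕ} (G : SimpleGraph (Fin m × Fin m)) (i : Fin m) : ℕ :=
  {j : Fin m | ∃ q : Fin m × Fin m, q.1 ≠ i ∧ G.Adj (i, j) q}.ncard

/-!
Lower bound. Choose in every clique three vertices without neighbours in other cliques and
give them the value `1/2`; this point of `P(G)` has coordinate sum `3m/2`. While descending a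
branch-and-bound tree, keep a half-integral point `x` (`IsHalfIntegralPacking`) such that the
set at the current node contains the face of `P(G)` on which the integral coordinates of `x` are
fixed (`halfIntegralFace`). A branching on an integral coordinate, or one with `K ≠ 0`, leaves this
face inside one child. A branching on a coordinate `v` with `x v = 1/2` is met in one child by
lowering `x v` to `0`, in the other by replacing `x` on the clique of `v` by the indicator of `v`.
As every clique carries weight at most `3/2`, both changes cost at most `1/2`. A leaf has
coordinate sum at most `m`, so the excess `m/2` of the initial point forces a complete
binary tree of depth `m` (`BBProof.two_pow_le_numNodes`).

Upper bound. In each clique, the inequalities `x₀ + ⋯ + xⱼ ≤ 1` are derived one after the other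
by branching on `xⱼ`: if `xⱼ ≤ 0`, the previous inequality suffices; if `xⱼ ≥ 1`, the edge
inequalities force the other summands to be nonpositive. This takes `m` cuts for each clique, `m²`
in total, and the last inequalities of the `m` cliques add up to the claim.
-/

/-! ### Half-integral points and their faces -/

/-- A half-integral point supported on vertices without neighbours in other cliques, such that
a coordinate `1` is the only nonzero coordinate of its clique and each clique has weight at
most `3/2`. -/
structure IsHalfIntegralPacking {m : ℕ} (G : SimpleGraph (Fin m × Fin m))
    (x : Fin m × Fin m → ℝ) : Prop where
  values : ∀ v, x v = 0 ∨ x v = 1 / 2 ∨ x v = 1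
  adj : ∀ v w, x v ≠ 0 → G.Adj v w → w.1 = v.1
  eq_zero : ∀ v w, x v = 1 → w.1 = v.1 → w ≠ v → x w = 0
  weight : ∀ i, ∑ j, x (i, j) ≤ 3 / 2

/-- The points of `P(G)` that agree with `x` in every coordinate where `x` differs from `1/2`. -/
def halfIntegralFace {V : Type*} (G : SimpleGraph V) (x : V → ℝ) : Set (V → ℝ) :=
  {y | y ∈ stablePolytope G ∧ ∀ v, x v ≠ 1 / 2 → y v = x v}

/-- The point `x` with its restriction to the clique of `v` replaced by the indicator of `v`. -/
noncomputable def selectVertex {m : ℕ} (x : Fin m × Fin m → ℝ) (v : Fin m × Fin m) :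
    Fin m × Fin m → ℝ :=
  fun w => if w.1 = v.1 then (if w = v then 1 else 0) else x w

namespace IsHalfIntegralPacking

variable {m : ℕ} {G : SimpleGraph (Fin m × Fin m)} {x : Fin m × Fin m → ℝ}

theorem mem_halfIntegralFace (hx : IsHalfIntegralPacking G x) : x ∈ halfIntegralFace G x := by
  have hle : ∀ v, 0 ≤ x v ∧ x v ≤ 1 := fun v => by
    rcases hx.values v with h | h | h <;> rw [h] <;> norm_num
  refine ⟨⟨fun u v huv => ?_, hle⟩, fun _ _ => rfl⟩
  by_cases hu : x u = 0
  · rw [hu, zero_add]; exact (hle v).2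
  have huv1 := hx.adj u v hu huv
  rcases hx.values u with h | h | h
  · exact absurd h hu
  · rcases hx.values v with h' | h' | h'
    · rw [h, h']; norm_num
    · rw [h, h']; norm_num
    · exact absurd (hx.eq_zero v u h' huv1.symm huv.ne) hu
  · rw [h, hx.eq_zero u v h huv1 huv.ne']; norm_num

theorem update_zero (hx : IsHalfIntegralPacking G x) (v : Fin m × Fin m) :
    IsHalfIntegralPacking G (Function.update x v 0) where
  values w := by
    by_cases h : w = v
    · subst h; simp
    · simpa [h] using hx.values w
  adj u w hu := by
    by_cases h : u = v
    · subst h; simp at hu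
    · rw [Function.update_of_ne h] at hu; exact hx.adj u w hu
  eq_zero u w hu hw hne := by
    by_cases h : u = v
    · subst h; simp at hu
    · rw [Function.update_of_ne h] at hu
      by_cases h' : w = v
      · subst h'; simp
      · rw [Function.update_of_ne h']; exact hx.eq_zero u w hu hw hne
  weight i := by
    refine le_trans (Finset.sum_le_sum fun j _ => ?_) (hx.weight i)
    by_cases h : (i, j) = v
    · subst h
      rw [Function.update_self]
      rcases hx.values (i, j) with h | h | h <;> rw [h] <;> norm_num
    · rw [Function.update_of_ne h]

end IsHalfIntegralPacking

theorem sum_selectVertex {m : ℕ} (x : Fin m × Fin m → ℝ) (v : Fin m × Fin m) (i : Fin m) :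
    ∑ j, selectVertex x v (i, j) = if i = v.1 then 1 else ∑ j, x (i, j) := by
  obtain ⟨a, b⟩ := v
  by_cases h : i = a
  · subst h; simp [selectVertex]
  · simp [selectVertex, h]

namespace IsHalfIntegralPacking

variable {m : ℕ} {G : SimpleGraph (Fin m × Fin m)} {x : Fin m × Fin m → ℝ}

theorem selectVertex (hx : IsHalfIntegralPacking G x) {v : Fin m × Fin m} (hv : x v ≠ 0) :
    IsHalfIntegralPacking G (selectVertex x v) where
  values w := by
    unfold _root_.selectVertex
    split_ifs
    · simp
    · simp
    · exact hx.values w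
  adj u w hu := by
    unfold _root_.selectVertex at hu
    split_ifs at hu with h1 h2
    · subst h2; exact hx.adj u w hv
    · simp at hu
    · exact hx.adj u w hu
  eq_zero u w hu hw hne := by
    unfold _root_.selectVertex at hu ⊢
    split_ifs at hu with h1 h2
    · subst h2; simp [hw, hne]
    · simp at hu
    · rw [if_neg (by rwa [hw])]; exact hx.eq_zero u w hu hw hne
  weight i := by
    rw [sum_selectVertex]
    split_ifs
    · norm_num
    · exact hx.weight i

theorem sum_sub_half_le_sum_selectVertex (hx : IsHalfIntegralPacking G x)
    (v : Fin m × Fin m) : ∑ w, x w - 1 / 2 ≤ ∑ w, _root_.selectVertex x v w := by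
  have key : ∀ i, ∑ j, x (i, j) - (if i = v.1 then 1 / 2 else 0) ≤
      ∑ j, _root_.selectVertex x v (i, j) := fun i => by
    rw [sum_selectVertex]
    split_ifs
    · linarith [hx.weight i]
    · simp
  have := Finset.sum_le_sum fun i (_ : i ∈ Finset.univ) => key i
  rw [Finset.sum_sub_distrib] at this
  simpa [Fintype.sum_prod_type] using this

end IsHalfIntegralPacking

theorem sum_update_zero {V : Type*} [Fintype V] [DecidableEq V] (x : V → ℝ) (v : V) :
    ∑ w, Function.update x v 0 w = ∑ w, x w - x v := by
  rw [Finset.sum_update_of_mem (Finset.mem_univ v), zero_add, ← Finset.erase_eq,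
    ← Finset.sum_erase_add _ _ (Finset.mem_univ v), add_sub_cancel_right]

theorem halfIntegralFace_update_zero_subset {V : Type*} [DecidableEq V] {G : SimpleGraph V}
    {x : V → ℝ} {v : V} (hv : x v = 1 / 2) :
    halfIntegralFace G (Function.update x v 0) ⊆ halfIntegralFace G x ∩ {y | y v ≤ 0} := by
  rintro y ⟨hy, hyx⟩
  refine ⟨⟨hy, fun w hw => ?_⟩, ?_⟩
  · have hwv : w ≠ v := by rintro rfl; exact hw hv
    have := hyx w
    rw [Function.update_of_ne hwv] at this
    exact this hw
  · have := hyx v (by simp)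
    rw [Function.update_self] at this
    exact this.le

theorem halfIntegralFace_selectVertex_subset {m : ℕ} {G : SimpleGraph (Fin m × Fin m)}
    {x : Fin m × Fin m → ℝ} (hx : IsHalfIntegralPacking G x) {v : Fin m × Fin m}
    (hv : x v = 1 / 2) :
    halfIntegralFace G (selectVertex x v) ⊆ halfIntegralFace G x ∩ {y | 1 ≤ y v} := by
  rintro y ⟨hy, hyx⟩
  refine ⟨⟨hy, fun w hw => ?_⟩, ?_⟩
  · have hwv : w ≠ v := by rintro rfl; exact hw hv
    have h := hyx w
    by_cases hc : w.1 = v.1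
    · simp only [selectVertex, hc, hwv, if_true, if_false] at h
      rw [h (by norm_num)]
      rcases hx.values w with h0 | h0 | h0
      · exact h0.symm
      · exact absurd h0 hw
      · -- A coordinate `1` in the clique of `v` would force `x v = 0`.
        have := hx.eq_zero w v h0 hc.symm hwv.symm
        rw [hv] at this; norm_num at this
    · simp only [selectVertex, hc, if_false] at h
      exact h hw
  · have h := hyx v
    simp only [selectVertex, if_true] at h
    exact (h (by norm_num)).ge

/-! ### The lower bound for branch and bound -/

/-- A variable disjunction other than `x v ≤ 0 ∨ x v ≥ 1` for a coordinate with `x v = 1/2` leaves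
the face of `x` inside one of its two sides. -/
theorem halfIntegralFace_subset_le_or_ge {m : ℕ} {G : SimpleGraph (Fin m × Fin m)}
    {x : Fin m × Fin m → ℝ} (hx : IsHalfIntegralPacking G x) {v : Fin m × Fin m} {K : ℤ}
    (h : ¬ (x v = 1 / 2 ∧ K = 0)) :
    halfIntegralFace G x ⊆ {y | y v ≤ K} ∨ halfIntegralFace G x ⊆ {y | (K : ℝ) + 1 ≤ y v} := by
  rcases lt_trichotomy K 0 with hK | hK | hK
  · right
    intro y hy
    have h1 : (K : ℝ) + 1 ≤ 0 := by exact_mod_cast hK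
    exact h1.trans (hy.1.2 v).1
  · subst hK
    have hv : x v ≠ 1 / 2 := fun h' => h ⟨h', rfl⟩
    rcases hx.values v with h0 | h0 | h0
    · left
      intro y hy
      simp [hy.2 v hv, h0]
    · exact absurd h0 hv
    · right
      intro y hy
      simp [hy.2 v hv, h0]
  · left
    intro y hy
    have h1 : (1 : ℝ) ≤ K := by exact_mod_cast hK
    exact (hy.1.2 v).2.trans h1

/-- If the set at the root contains the face of a half-integral point whose coordinate sum exceeds
the bound by `k/2`, the tree contains a complete binary tree of depth `k`. -/
theorem BBProof.two_pow_le_numNodes {m : ℕ} {G : SimpleGraph (Fin m × Fin m)} {γ : ℝ}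
    {C : Set (Fin m × Fin m → ℝ)}
    (t : BBProof (varDisjunctions (Fin m × Fin m)) (fun _ => 1) γ C)
    (x : Fin m × Fin m → ℝ) (hx : IsHalfIntegralPacking G x) (hC : halfIntegralFace G x ⊆ C)
    (k : ℕ) (hk : γ + k / 2 ≤ ∑ v, x v) : 2 ^ (k + 1) ≤ t.numNodes + 1 := by
  induction t generalizing x k with
  | leaf C h =>
    have h1 := h x (hC hx.mem_halfIntegralFace)
    simp only [dotProduct, one_mul] at h1
    have hk0 : k = 0 := by
      have : (k : ℝ) ≤ 0 := by linarith
      exact Nat.le_zero.1 (by exact_mod_cast this)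
    subst hk0
    simp [numNodes]
  | branch C D hD child ih =>
    obtain ⟨v, K, rfl⟩ := id hD
    have hsum : (branch C (varDisjunction v K) hD child).numNodes =
        1 + ((child (0 : Fin 2)).numNodes + (child (1 : Fin 2)).numNodes) := by
      rw [numNodes]
      exact congrArg _ (Fin.sum_univ_two fun i : Fin 2 => (child i).numNodes)
    rw [hsum]
    by_cases h : x v = 1 / 2 ∧ K = 0
    · obtain ⟨hv, rfl⟩ := h
      cases k with
      | zero => omega
      | succ k =>
        push_cast at hk
        have h0 := ih (0 : Fin 2) (Function.update x v 0) (hx.update_zero v)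
          (fun y hy => by
            have := halfIntegralFace_update_zero_subset hv hy
            refine ⟨hC this.1, ?_⟩
            change y v ≤ ((0 : ℤ) : ℝ)
            rw [Int.cast_zero]
            exact this.2) k
          (by rw [sum_update_zero, hv]; linarith)
        have h1 := ih (1 : Fin 2) (selectVertex x v)
          (hx.selectVertex (by rw [hv]; norm_num))
          (fun y hy => by
            have := halfIntegralFace_selectVertex_subset hx hv hy
            refine ⟨hC this.1, ?_⟩
            change ((0 : ℤ) : ℝ) + 1 ≤ y v
            rw [Int.cast_zero, zero_add]
            exact this.2) k
          (by linarith [hx.sum_sub_half_le_sum_selectVertex v])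
        rw [pow_succ]
        omega
    · rcases halfIntegralFace_subset_le_or_ge hx h with h' | h'
      · have := ih (0 : Fin 2) x hx (fun y hy => ⟨hC hy, h' hy⟩) k hk
        omega
      · have := ih (1 : Fin 2) x hx (fun y hy => ⟨hC hy, h' hy⟩) k hk
        omega

/-- If each clique has three vertices without neighbours in other cliques, then giving these the
value `1/2` yields a half-integral point of coordinate sum `3m/2`. -/
theorem exists_isHalfIntegralPacking {m : ℕ} {G : SimpleGraph (Fin m × Fin m)}
    (h : ∀ i, numConnected G i + 3 ≤ m) :
    ∃ x, IsHalfIntegralPacking G x ∧ ∑ v, x v = 3 / 2 * m := by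
  classical
  have hT : ∀ i, ∃ T : Finset (Fin m), T.card = 3 ∧
      ∀ j ∈ T, ∀ q, G.Adj (i, j) q → q.1 = i := fun i => by
    set A : Set (Fin m) := {j | ∃ q : Fin m × Fin m, q.1 ≠ i ∧ G.Adj (i, j) q} with hA
    have hcard : A.ncard + Aᶜ.ncard = m := by
      simpa using Set.ncard_add_ncard_compl A
    have hi : A.ncard + 3 ≤ m := h i
    obtain ⟨T, hTA, hT3⟩ := Finset.exists_subset_card_eq
      (show 3 ≤ Aᶜ.toFinset.card by rw [← Set.ncard_eq_toFinset_card']; omega)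
    refine ⟨T, hT3, fun j hj q hq => ?_⟩
    have hjA : j ∈ Aᶜ := Set.mem_toFinset.1 (hTA hj)
    by_contra hne
    exact hjA ⟨q, hne, hq⟩
  choose T hT3 hTadj using hT
  have hw : ∀ i, ∑ j, (if j ∈ T i then (1 / 2 : ℝ) else 0) = 3 / 2 := fun i => by
    rw [Finset.sum_ite_mem, Finset.univ_inter, Finset.sum_const, hT3]; norm_num
  refine ⟨fun v => if v.2 ∈ T v.1 then 1 / 2 else 0, ⟨fun v => ?_, ?_, ?_, fun i => (hw i).le⟩, ?_⟩
  · by_cases hv : v.2 ∈ T v.1 <;> simp [hv]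
  · intro v w hv
    have hmem : v.2 ∈ T v.1 := by
      by_contra hn; exact hv (if_neg hn)
    exact hTadj v.1 v.2 hmem w
  · intro v w hv
    split_ifs at hv <;> norm_num at hv
  · rw [Fintype.sum_prod_type]
    simp only [hw]
    simp [mul_comm]

/-! ### The cutting plane proof -/

/-- The halfspace `x (i, 0) + ⋯ + x (i, j) ≤ 1`. -/
def prefixCut {m : ℕ} (i j : Fin m) : Set (Fin m × Fin m → ℝ) :=
  {x | ∑ l ∈ Finset.Iic j, x (i, l) ≤ 1}

theorem isHalfspace_prefixCut {m : ℕ} (i j : Fin m) : IsHalfspace (prefixCut i j) := by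
  refine ⟨fun v => if v.1 = i ∧ v.2 ∈ Finset.Iic j then 1 else 0, 1, fun h => ?_, ?_⟩
  · have := congrFun h (i, j)
    simp at this
  · ext x
    have : (∑ v : Fin m × Fin m, (if v.1 = i ∧ v.2 ∈ Finset.Iic j then (1 : ℝ) else 0) * x v) =
        ∑ l ∈ Finset.Iic j, x (i, l) := by
      rw [Fintype.sum_prod_type, Finset.sum_eq_single i]
      · simp only [true_and, ite_mul, one_mul, zero_mul]
        rw [Finset.sum_ite_mem, Finset.univ_inter]
      · intro b _ hb
        simp [hb]
      · simp
    simp only [prefixCut, dotProduct, Set.mem_ofPred_eq]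
    rw [this]

/-- The prefix inequality at `j` follows from the disjunction on `x (i, j)` and the prefix
inequality at the predecessor of `j`. -/
theorem mem_prefixCut {m : ℕ} {G : SimpleGraph (Fin m × Fin m)} (hG : disjointCliques m ≤ G)
    {x : Fin m × Fin m → ℝ} (hx : x ∈ stablePolytope G) {i j : Fin m}
    (hprev : ∀ l : Fin m, (l : ℕ) + 1 = j → x ∈ prefixCut i l)
    (hD : x ∈ (varDisjunction (i, j) 0).toSet) : x ∈ prefixCut i j := by
  obtain ⟨p, hp⟩ := Set.mem_iUnion.1 hD
  change ∑ l ∈ Finset.Iic j, x (i, l) ≤ 1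
  rw [← Finset.Iio_insert, Finset.sum_insert (by simp)]
  have hcase : x (i, j) ≤ ((0 : ℤ) : ℝ) ∨ ((0 : ℤ) : ℝ) + 1 ≤ x (i, j) := by
    change Fin 2 at p
    fin_cases p
    · exact Or.inl hp
    · exact Or.inr hp
  rw [Int.cast_zero, zero_add] at hcase
  rcases hcase with h | h
  · have hs : ∑ l ∈ Finset.Iio j, x (i, l) ≤ 1 := by
      by_cases hj : (j : ℕ) = 0
      · have : Finset.Iio j = ∅ := by
          ext l
          simp [Fin.lt_def, hj]
        rw [this]; simp
      · have hl : (j : ℕ) - 1 < m := by omega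
        have hIic : Finset.Iio j = Finset.Iic ⟨(j : ℕ) - 1, hl⟩ := by
          ext l
          simp only [Finset.mem_Iio, Finset.mem_Iic, Fin.lt_def, Fin.le_def]
          omega
        rw [hIic]
        exact hprev ⟨(j : ℕ) - 1, hl⟩ (by simp only; omega)
    linarith
  · have hs : ∑ l ∈ Finset.Iio j, x (i, l) ≤ 0 := by
      refine Finset.sum_nonpos fun l hl => ?_
      have hne : l ≠ j := (Finset.mem_Iio.1 hl).ne
      have hadj : G.Adj (i, l) (i, j) := hG ⟨rfl, fun he => hne (congrArg Prod.snd he)⟩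
      linarith [hx.1 _ _ hadj]
    linarith [(hx.2 (i, j)).2]

/-- The prefix inequalities of all cliques, in lexicographic order, form a cutting plane proof. -/
theorem isCPProof_prefixCut {m : ℕ} {G : SimpleGraph (Fin m × Fin m)}
    (hG : disjointCliques m ≤ G) :
    IsCPProof (varDisjunctions (Fin m × Fin m)) (stablePolytope G) (fun _ => 1) (m : ℝ)
      (fun n : Fin (m * m) =>
        prefixCut (finProdFinEquiv.symm n).1 (finProdFinEquiv.symm n).2) := by
  refine ⟨⟨fun n => varDisjunction (finProdFinEquiv.symm n) 0,
    fun n => ⟨⟨_, _, rfl⟩, isHalfspace_prefixCut _ _, ?_⟩⟩, ?_⟩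
  · obtain ⟨⟨i, j⟩, rfl⟩ := finProdFinEquiv.surjective n
    beta_reduce
    rw [Equiv.symm_apply_apply]
    rintro x ⟨⟨hx, hcut⟩, hD⟩
    refine mem_prefixCut hG hx (fun l hl => ?_) hD
    have hlt : finProdFinEquiv (i, l) < finProdFinEquiv (i, j) := by
      rw [Fin.lt_def]
      simp only [finProdFinEquiv_apply_val]
      change (l : ℕ) + 1 = (j : ℕ) at hl
      omega
    have := Set.mem_iInter₂.1 hcut _ hlt
    beta_reduce at this
    rwa [Equiv.symm_apply_apply] at this
  · rintro x ⟨-, hcut⟩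
    have hclique : ∀ i, ∑ j, x (i, j) ≤ 1 := fun i => by
      have hm : m - 1 < m := by have := i.isLt; omega
      have := Set.mem_iInter.1 hcut (finProdFinEquiv (i, ⟨m - 1, hm⟩))
      beta_reduce at this
      rw [Equiv.symm_apply_apply] at this
      have hIic : Finset.Iic (⟨m - 1, hm⟩ : Fin m) = Finset.univ := by
        ext l
        simp only [Finset.mem_Iic, Fin.le_def, Finset.mem_univ, iff_true]
        omega
      change ∑ l ∈ Finset.Iic (⟨m - 1, hm⟩ : Fin m), x (i, l) ≤ 1 at this
      rwa [hIic] at this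
    simp only [dotProduct, one_mul]
    rw [Fintype.sum_prod_type]
    calc ∑ i, ∑ j, x (i, j) ≤ ∑ _i : Fin m, (1 : ℝ) := Finset.sum_le_sum fun i _ => hclique i
      _ = m := by simp

theorem mainTheorem11 :
    ∃ K : ℕ, ∀ (α : ℝ), 0 ≤ α → α < 1 → ∀ (m : ℕ) (G : SimpleGraph (Fin m × Fin m)),
      disjointCliques m ≤ G → (∀ i, (numConnected G i : ℝ) ≤ α * m) →
      (3 / (1 - α) ≤ (m : ℝ) →
        ∀ t : BBProof (varDisjunctions (Fin m × Fin m)) (fun _ => 1) (m : ℝ) (stablePolytope G),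
          2 ^ (m + 1) - 2 ≤ t.size) ∧
      ∃ N : ℕ, N ≤ K * m ^ 4 ∧ ∃ H : Fin N → Set (Fin m × Fin m → ℝ),
        IsCPProof (varDisjunctions (Fin m × Fin m)) (stablePolytope G) (fun _ => 1) (m : ℝ) H := by
  refine ⟨1, fun α _ hα m G hG hconn => ⟨fun hm t => ?_, m * m, ?_, _, isCPProof_prefixCut hG⟩⟩
  · rw [div_le_iff₀ (by linarith)] at hm
    obtain ⟨x, hx, hsum⟩ := exists_isHalfIntegralPacking (G := G) fun i => by
      have : (numConnected G i : ℝ) + 3 ≤ m := by linarith [hconn i]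
      exact_mod_cast this
    have := t.two_pow_le_numNodes x hx (fun y hy => hy.1) m (by rw [hsum]; linarith)
    unfold BBProof.size
    omega
  · rw [one_mul, ← pow_two]
    rcases Nat.eq_zero_or_pos m with rfl | h
    · simp
    · exact Nat.pow_le_pow_right h (by norm_num)
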